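/- **Theorem 3.1.** Let $f:\mathbb R\to\mathbb R$ be of class $C^2$ and $h>0$. A *front-tracking approximation* (with parameter $h$) of $\partial_t u+\partial_x f(u)=0$ is a function $u(x,t)$, $x\in\mathbb R$, $t\ge 0$, right-continuous in $x$, for which there are finitely many times $0=T_0<T_1<\dots<T_N$ such that, on each of $[T_0,T_1],\dots,[T_{N-1},T_N],[T_N,\infty)$, $u$ is piecewise constant with finitely many jumps, which travel along straight lines (fronts) not meeting in the interior of the time interval, and such that: * every front satisfies the Rankine–Hugoniot relation $\sigma\,(u_+-u_-)=f(u_+)-f(u_-)$, where $\sigma$ is its speed and $u_-\ne u_+$ are its left and right states; * every front is either a Lax shock, i.e. it satisfies the Oleinik inequalities $\frac{f(w)-f(u_-)}{w-u_-}\ge\frac{f(u_+)-f(u_-)}{u_+-u_-}$ for all $w$ strictly between $u_-$ and $u_+$, or it is small: $|u_+-u_-|\le h$ (rarefaction front); * the fronts that issue from one point at a time $T_k$ form a monotone fan: their jumps $u_+-u_-$ all have the same sign. Let $u^{I,h}$ and $u^{II,h}$ be two front-tracking approximations with parameter $h$, and put $$a^h(x,t)=\frac{f(u^{II,h}(x,t))-f(u^{I,h}(x,t))}{u^{II,h}(x,t)-u^{I,h}(x,t)}\quad\bigl(=f'(u^{I,h}(x,t))\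 \text{where } u^{I,h}(x,t)=u^{II,h}(x,t)\bigr).$$ Let $\mathcal L(a^h)$ be the set of Lax discontinuities of $a^h$: the points $(x,t)$, $t>0$, near which $a^h$ takes exactly two constant values, separated by a straight line through $(x,t)$ of speed $\lambda^{a^h}(x,t)$, and at which $a^h(x-,t)>\lambda^{a^h}(x,t)>a^h(x+,t)$. Let $\|f''\|_\infty$ be the supremum of $|f''|$ over any fixed convex set $C\subseteq\mathbb R$ (for instance $C=\mathbb R$) that contains all values of $u^{I,h}$ and $u^{II,h}$. Then for all $0\le s\le t$ $$\begin{aligned}&\|u^{II,h}(t)-u^{I,h}(t)\|_{L^1(\mathbb R)}+\int_s^t\sum_{(x,\tau)\in\mathcal L(a^h)}2\,\bigl(a^h(x-,\tau)-\lambda^{a^h}(x,\tau)\bigr)\,\bigl|u^{II,h}(x-,\tau)-u^{I,h}(x-,\tau)\bigr|\,d\tau\\&\qquad\le\ \|u^{II,h}(s)-u^{I,h}(s)\|_{L^1(\mathbb R)}+2h\,(t-s)\,\|f''\|_\infty\,\Bigl(TV(u^{I,h}(0))+TV(u^{II,h}(0))\Bigr).\end{aligned}$$ Here all terms are in $[0,\infty]$,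 with $0\cdot\infty=0$. -/

import Mathlib

open Set Filter Topology MeasureTheory
open scoped ENNReal

namespace FrontTracking

/-! ### Piecewise constant front-tracking approximations of `∂ₜ u + ∂ₓ f(u) = 0`

Functions of space and time are written `u : ℝ → ℝ → ℝ`, with `u x t` the value at position `x` and
time `t`; only times `t ≥ 0` matter. -/

/-- The Oleinik entropy inequalities for a jump from the left state `l` to the right state `r`:
`(f w - f l) / (w - l) ≥ (f r - f l) / (r - l)` for every `w` strictly between `l` and `r`. -/
def Oleinik (f : ℝ → ℝ) (l r : ℝ) : Prop :=
  ∀ w, (l < w ∧ w < r ∨ r < w ∧ w < l) → (f r - f l) / (r - l) ≤ (f w - f l) / (w - l)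

/-- On the time interval `I`, which starts at time `τ`, the function `u` is piecewise constant with
exactly `n` fronts (jump lines). The `j`-th front is the straight line `x = y j + σ j * (t - τ)`, and
it separates the constant state `c j` on its left from the constant state `c (j + 1)` on its
right. The fronts do not meet in the interior of `I`; several of them may start from the same point
at time `τ`, and they may meet at the end of `I`. -/
structure IsFrontStrip (f : ℝ → ℝ) (h : ℝ) (u : ℝ → ℝ → ℝ) (τ : ℝ) (I : Set ℝ) {n : ℕ}
    (y σ : Fin n → ℝ) (c : Fin (n + 1) → ℝ) : Prop where
  /-- inside the time interval the fronts are distinct and numbered from left to right -/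
  ordered : ∀ t ∈ interior I, StrictMono fun j => y j + σ j * (t - τ)
  /-- `u` takes the value `c i` between the front number `i - 1` (included, so that `u` is
  right-continuous in space) and the front number `i` (excluded) -/
  value : ∀ t ∈ I, ∀ x, ∀ i : Fin (n + 1),
    (∀ j : Fin n, j.castSucc < i → y j + σ j * (t - τ) ≤ x) →
    (∀ j : Fin n, i ≤ j.castSucc → x < y j + σ j * (t - τ)) → u x t = c i
  /-- the fronts are jumps -/
  jump : ∀ j : Fin n, c j.castSucc ≠ c j.succ
  /-- the Rankine-Hugoniot relation for the flux `f` -/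
  rankineHugoniot : ∀ j : Fin n,
    σ j * (c j.succ - c j.castSucc) = f (c j.succ) - f (c j.castSucc)
  /-- every front is either a Lax shock, satisfying the Oleinik entropy inequalities, or a
  rarefaction jump, whose strength is at most `h` -/
  shock_or_small : ∀ j : Fin n,
    Oleinik f (c j.castSucc) (c j.succ) ∨ |c j.succ - c j.castSucc| ≤ h
  /-- the fronts issuing from one point at time `τ` solve the Riemann problem at that point by a
  monotone fan: their jumps all have the same sign -/
  fan : ∀ i j : Fin n, y i = y j → 0 < (c i.succ - c i.castSucc) * (c j.succ - c j.castSucc)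

/-- `u` is a front-tracking approximate solution of `∂ₜ u + ∂ₓ f(u) = 0` with parameter `h`, for
`t ≥ 0`. There are finitely many times `0 = T 0 < T 1 < ⋯ < T N` (these include all times at which
fronts interact). On each `[T k, T (k + 1)]` with `k < N` and on `[T N, ∞)`, `u` consists of
finitely many fronts that are straight lines, satisfy the Rankine-Hugoniot relation, and are either
Lax shocks or rarefaction jumps of strength at most `h`. At time `T 0 = 0` and at each interaction
the Riemann problem is solved by a monotone fan of such fronts. The value `u x (T (k + 1))` is
prescribed by both adjacent intervals, so that `u` is continuous in time with values in
`L¹` locally. -/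
def IsFrontTracking (f : ℝ → ℝ) (h : ℝ) (u : ℝ → ℝ → ℝ) : Prop :=
  ∃ (N : ℕ) (T : ℕ → ℝ), T 0 = 0 ∧ (∀ k < N, T k < T (k + 1)) ∧
    (∀ k < N, ∃ (n : ℕ) (y σ : Fin n → ℝ) (c : Fin (n + 1) → ℝ),
      IsFrontStrip f h u (T k) (Icc (T k) (T (k + 1))) y σ c) ∧
    ∃ (n : ℕ) (y σ : Fin n → ℝ) (c : Fin (n + 1) → ℝ),
      IsFrontStrip f h u (T N) (Ici (T N)) y σ c

/-! ### Jump points and Lax discontinuities of a piecewise constant coefficient -/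

/-- `(x, t)` is a jump point of `a`, lying on a discontinuity line of speed `σ`: near `(x, t)` the
function `a` takes one constant value on the left of the line, and another one on the right. -/
def IsJumpWithSpeed (a : ℝ → ℝ → ℝ) (x t σ : ℝ) : Prop :=
  ∃ l r : ℝ, l ≠ r ∧ ∀ᶠ p : ℝ × ℝ in 𝓝 (x, t),
    (p.1 < x + σ * (p.2 - t) → a p.1 p.2 = l) ∧ (x + σ * (p.2 - t) < p.1 → a p.1 p.2 = r)

open Classical in
/-- The speed of the discontinuity of `a` at the jump point `(x, t)`
(and `0` if `(x, t)` is not a jump point). -/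
noncomputable def jumpSpeed (a : ℝ → ℝ → ℝ) (x t : ℝ) : ℝ :=
  if H : ∃ σ, IsJumpWithSpeed a x t σ then H.choose else 0

/-- The left-hand trace `g (x-, t)`. -/
noncomputable def leftTrace (g : ℝ → ℝ → ℝ) (x t : ℝ) : ℝ :=
  Function.leftLim (fun y => g y t) x

/-- The right-hand trace `g (x+, t)`. -/
noncomputable def rightTrace (g : ℝ → ℝ → ℝ) (x t : ℝ) : ℝ :=
  Function.rightLim (fun y => g y t) x

/-- The set of Lax discontinuities of `a`: the jump points `(x, t)`, `t > 0`, at which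
`a (x-, t) > σ > a (x+, t)`, where `σ` is the speed of the discontinuity. -/
def laxSet (a : ℝ → ℝ → ℝ) : Set (ℝ × ℝ) :=
  {p | 0 < p.2 ∧ (∃ σ, IsJumpWithSpeed a p.1 p.2 σ) ∧
    rightTrace a p.1 p.2 < jumpSpeed a p.1 p.2 ∧ jumpSpeed a p.1 p.2 < leftTrace a p.1 p.2}

/-- The averaging coefficient `(f(v) - f(u)) / (v - u)`, which is `f'(u)` where `v = u`. -/
noncomputable def avgSpeed (f : ℝ → ℝ) (u v : ℝ → ℝ → ℝ) (x t : ℝ) : ℝ :=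
  dslope f (u x t) (v x t)

/-- The `L¹` distance on the real line of `u` and `v` at time `t` (possibly `∞`). -/
noncomputable def l1Dist (u v : ℝ → ℝ → ℝ) (t : ℝ) : ℝ≥0∞ :=
  eLpNorm (fun x => v x t - u x t) 1 volume

/-- The total variation of `u` at time `t` on the real line. -/
noncomputable def totalVariation (u : ℝ → ℝ → ℝ) (t : ℝ) : ℝ≥0∞ :=
  eVariationOn (fun x => u x t) univ

/-- The rate at time `τ` at which the Lax discontinuities of `a` dissipate the `L¹` distance: the
sum over all Lax discontinuities `(x, τ)` of
`2 (a(x-, τ) - σ(x, τ)) |v(x-, τ) - u(x-, τ)|`; its terms are nonnegative. -/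
noncomputable def laxDissipation (a u v : ℝ → ℝ → ℝ) (τ : ℝ) : ℝ≥0∞ :=
  ∑' x : {x : ℝ // (x, τ) ∈ laxSet a},
    ENNReal.ofReal (2 * (leftTrace a x τ - jumpSpeed a x τ) * |leftTrace v x τ - leftTrace u x τ|)

/-- The speed of a discontinuity is uniquely determined. -/
theorem IsJumpWithSpeed.unique {a : ℝ → ℝ → ℝ} {x t σ₁ σ₂ : ℝ}
    (h₁ : IsJumpWithSpeed a x t σ₁) (h₂ : IsJumpWithSpeed a x t σ₂) : σ₁ = σ₂ := by
  by_contra hne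
  wlog hlt : σ₁ < σ₂ generalizing σ₁ σ₂
  · exact this h₂ h₁ (Ne.symm hne) (lt_of_le_of_ne (not_lt.mp hlt) (Ne.symm hne))
  obtain ⟨l₁, r₁, hlr₁, e₁⟩ := h₁
  obtain ⟨l₂, r₂, -, e₂⟩ := h₂
  have path : ∀ m : ℝ, Tendsto (fun s : ℝ => (x + m * s, t + s)) (𝓝 0) (𝓝 (x, t)) := by
    intro m
    have : Continuous fun s : ℝ => (x + m * s, t + s) := by fun_prop
    simpa using this.tendsto 0
  have ev := e₁.and e₂
  have hm := (path ((σ₁ + σ₂) / 2)).eventually ev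
  have hl := (path (σ₁ - 1)).eventually ev
  obtain ⟨ε, hε, H⟩ := Metric.eventually_nhds_iff.mp (hm.and hl)
  have d : dist (ε / 2) 0 < ε := by
    rw [Real.dist_eq, sub_zero, abs_of_pos (by positivity)]; linarith
  obtain ⟨⟨a1, a2⟩, b1, b2⟩ := H d
  have p1 := a1.2 (by dsimp only; nlinarith)
  have p2 := a2.1 (by dsimp only; nlinarith)
  have q1 := b1.1 (by dsimp only; nlinarith)
  have q2 := b2.1 (by dsimp only; nlinarith)
  exact hlr₁ (q1.symm.trans (q2.trans (p2.symm.trans p1)))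

end FrontTracking

/-! Let U, V be the states of the two solutions on the left of a line of speed σ, U', V' those on
the right, and a, a' the averaging coefficients, so that a (V - U) = f V - f U. Away from the
finitely many times at which fronts of one solution interact or fronts of the two solutions cross,
both solutions are step functions along one family of disjoint lines. If their L¹ distance is
finite, it is then affine in time, with slope the sum over the lines of σ (|V - U| - |V' - U'|). By
Rankine-Hugoniot, Q = (a - σ)(V - U) is the same on both sides of a line. After subtraction of the
telescoping flux a |V - U|, a line contributes -2|Q| at a Lax discontinuity, which is the
dissipation term, nothing if a - σ keeps its sign, and 2|Q| if a < σ < a' (`front_balance`).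

In the last case, unless Q = 0, V - U changes sign. Hence a state of one solution lies strictly
inside the jump of the other and violates the Oleinik inequality there. That jump is therefore at
most h, and the mean value theorem gives |Q| ≤ h M |jump|, where M bounds |f''| (`chord_le`,
`rarefaction_le_of_lt`).

The jump strengths on each strip sum to at most the initial total variation: monotone fans hide no
variation at the start of a strip (`IsStep.le_eVariationOn`), and collisions can only cancel it. The
estimates on short intervals add up in time. -/

namespace FrontTracking

/-! ### Step functions of one variable -/

/-- A downward closed predicate on `Fin n` is given by a threshold in `Fin (n + 1)`. -/
theorem exists_threshold {n : ℕ} (p : Fin n → Prop) (hp : ∀ i j, i ≤ j → p j → p i) :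
    ∃ e : Fin (n + 1), ∀ j : Fin n, j.castSucc < e ↔ p j := by
  classical
  by_cases hall : ∀ j, p j
  · exact ⟨Fin.last n, fun j => ⟨fun _ => hall j, fun _ => Fin.castSucc_lt_last j⟩⟩
  · push Not at hall
    obtain ⟨j₀, h₀, hmin⟩ := WellFounded.has_min (wellFounded_lt (α := Fin n)) {j | ¬ p j} hall
    refine ⟨j₀.castSucc, fun j => ⟨fun hj => ?_, fun hj => ?_⟩⟩
    · by_contra hpj
      exact hmin j hpj (Fin.castSucc_lt_castSucc_iff.mp hj)
    · by_contra hlt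
      exact h₀ (hp _ _ (Fin.castSucc_le_castSucc_iff.mp (not_lt.mp hlt)) hj)

theorem sum_ite_lt_sub {n : ℕ} (g : Fin (n + 1) → ℝ) (e : Fin (n + 1)) :
    ∑ j : Fin n, (if j.castSucc < e then g j.succ - g j.castSucc else 0) = g e - g 0 := by
  induction e using Fin.induction with
  | zero => simp
  | succ i ih =>
    have key : ∀ j : Fin n, (if j.castSucc < i.succ then g j.succ - g j.castSucc else 0)
        = (if j.castSucc < i.castSucc then g j.succ - g j.castSucc else 0)
          + (if j = i then g j.succ - g j.castSucc else 0) := by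
      intro j
      rcases lt_trichotomy j i with hj | hj | hj
      · have h1 : j.castSucc < i.succ := Fin.castSucc_lt_succ_iff.mpr hj.le
        simp [h1, hj, hj.ne]
      · subst hj; simp
      · have h1 : ¬ j.castSucc < i.succ := fun h => hj.not_ge (Fin.castSucc_lt_succ_iff.mp h)
        simp [h1, hj.le, hj.ne']
    simp only [key, Finset.sum_add_distrib, ih, Finset.sum_ite_eq', Finset.mem_univ, if_true]
    ring

theorem sum_succ_sub {n : ℕ} (g : Fin (n + 1) → ℝ) :
    ∑ j : Fin n, (g j.succ - g j.castSucc) = g (Fin.last n) - g 0 := by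
  simpa [Fin.castSucc_lt_last] using sum_ite_lt_sub g (Fin.last n)

/-- `g` takes the values `c 0, c 1, …` on the intervals between the successive positions
`w 0, w 1, …`, and is right-continuous. -/
def IsStep (g : ℝ → ℝ) {n : ℕ} (w : Fin n → ℝ) (c : Fin (n + 1) → ℝ) : Prop :=
  ∀ x, ∀ i : Fin (n + 1), (∀ j : Fin n, j.castSucc < i → w j ≤ x) →
    (∀ j : Fin n, i ≤ j.castSucc → x < w j) → g x = c i

section

variable {g : ℝ → ℝ} {n : ℕ} {w : Fin n → ℝ} {c : Fin (n + 1) → ℝ}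

theorem exists_cell (hw : Monotone w) (x : ℝ) :
    ∃ e : Fin (n + 1), ∀ j : Fin n, j.castSucc < e ↔ w j ≤ x :=
  exists_threshold (fun j => w j ≤ x) fun _ _ hij hj => (hw hij).trans hj

theorem IsStep.eq_of_cell (hg : IsStep g w c) {x : ℝ} {e : Fin (n + 1)}
    (he : ∀ j : Fin n, j.castSucc < e ↔ w j ≤ x) : g x = c e :=
  hg x e (fun j hj => (he j).mp hj) fun j hj => not_le.mp fun h => absurd ((he j).mpr h) (not_lt.mpr hj)

theorem IsStep.comp₂ {g' : ℝ → ℝ} {c' : Fin (n + 1) → ℝ} (hg : IsStep g w c) (hg' : IsStep g' w c')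
    (φ : ℝ → ℝ → ℝ) : IsStep (fun x => φ (g x) (g' x)) w fun i => φ (c i) (c' i) := by
  intro x i h1 h2
  simp only [hg x i h1 h2, hg' x i h1 h2]

theorem IsStep.eq_sum (hw : Monotone w) (hg : IsStep g w c) (x : ℝ) :
    g x = c 0 + ∑ j : Fin n, if w j ≤ x then c j.succ - c j.castSucc else 0 := by
  obtain ⟨e, he⟩ := exists_cell hw x
  rw [hg.eq_of_cell he]
  simp only [← he]
  rw [sum_ite_lt_sub]; ring

theorem IsStep.eq_first (hg : IsStep g w c) {x : ℝ} (hx : ∀ j, x < w j) : g x = c 0 :=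
  hg x 0 (fun j hj => absurd hj (by simp)) fun j _ => hx j

theorem IsStep.eq_last (hg : IsStep g w c) {x : ℝ} (hx : ∀ j, w j ≤ x) : g x = c (Fin.last n) :=
  hg x (Fin.last n) (fun j _ => hx j) fun j hj => absurd (Fin.castSucc_lt_last j) (not_lt.mpr hj)

/-- Cut each Heaviside jump off at a common `R` to the right of all positions. The jumps sum to
zero, so nothing is lost beyond `R` and `R` drops out of the integral. -/
theorem IsStep.integrable_and_integral (hw : Monotone w) (hg : IsStep g w c) (h0 : c 0 = 0)
    (h1 : c (Fin.last n) = 0) :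
    Integrable g ∧ ∫ x, g x = ∑ j : Fin n, w j * (c j.castSucc - c j.succ) := by
  obtain ⟨R, hR⟩ := (Set.finite_range w).bddAbove
  have hR' : ∀ j, w j ≤ R := fun j => hR ⟨j, rfl⟩
  have hsum : ∑ j : Fin n, (c j.succ - c j.castSucc) = 0 := by rw [sum_succ_sub, h0, h1, sub_zero]
  have hrep : g = fun x => ∑ j : Fin n,
      (Ico (w j) R).indicator (fun _ => c j.succ - c j.castSucc) x := by
    funext x
    rw [hg.eq_sum hw x, h0, zero_add]
    rcases lt_or_ge x R with hx | hx
    · exact Finset.sum_congr rfl fun j _ => by simp [Set.indicator, hx]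
    · have : ∀ j, w j ≤ x := fun j => (hR' j).trans hx
      simp [this, hx.not_gt, hsum]
  have hint : ∀ j ∈ Finset.univ, Integrable
      ((Ico (w j) R).indicator fun _ : ℝ => c j.succ - c j.castSucc) := fun j _ =>
    (integrable_indicator_iff measurableSet_Ico).mpr (by simp [integrableOn_const_iff])
  refine ⟨by rw [hrep]; exact integrable_finsetSum _ hint, ?_⟩
  rw [hrep, integral_finsetSum _ hint]
  have : ∀ j : Fin n, ∫ x, (Ico (w j) R).indicator (fun _ : ℝ => c j.succ - c j.castSucc) x
      = R * (c j.succ - c j.castSucc) + w j * (c j.castSucc - c j.succ) := by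
    intro j
    rw [integral_indicator measurableSet_Ico, setIntegral_const, Measure.real, Real.volume_Ico,
      ENNReal.toReal_ofReal (by linarith [hR' j]), smul_eq_mul]
    ring
  simp only [this, Finset.sum_add_distrib, ← Finset.mul_sum, hsum, mul_zero, zero_add]

theorem IsStep.eq_zero_of_lintegral_ne_top (hg : IsStep g w c) (hfin : ∫⁻ x, ‖g x‖ₑ ≠ ∞) :
    c 0 = 0 ∧ c (Fin.last n) = 0 := by
  have main : ∀ (S : Set ℝ) (a : ℝ), MeasurableSet S → volume S = ∞ → (∀ x ∈ S, g x = a) →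
      a = 0 := by
    intro S a hS hvol hga
    by_contra ha
    apply hfin
    rw [eq_top_iff]
    calc (∞ : ℝ≥0∞) = ‖a‖ₑ * volume S := by rw [hvol, ENNReal.mul_top (by simpa using ha)]
      _ = ∫⁻ _ in S, ‖a‖ₑ := by rw [setLIntegral_const]
      _ = ∫⁻ x in S, ‖g x‖ₑ := setLIntegral_congr_fun hS fun x hx => by simp only [hga x hx]
      _ ≤ _ := setLIntegral_le_lintegral _ _
  constructor
  · obtain ⟨R, hR⟩ := (Set.finite_range w).bddBelow
    exact main (Iio R) _ measurableSet_Iio Real.volume_Iio fun x hx =>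
      hg.eq_first fun j => lt_of_lt_of_le hx (hR ⟨j, rfl⟩)
  · obtain ⟨R, hR⟩ := (Set.finite_range w).bddAbove
    exact main (Ici R) _ measurableSet_Ici Real.volume_Ici fun x hx =>
      hg.eq_last fun j => (hR ⟨j, rfl⟩).trans hx

/-- Increments of `g` are dominated by those of the cumulative jump strength `Φ`, which is bounded
by the full sum. -/
theorem IsStep.eVariationOn_le (hw : Monotone w) (hg : IsStep g w c) :
    eVariationOn g univ ≤ ENNReal.ofReal (∑ j : Fin n, |c j.succ - c j.castSucc|) := by
  set Φ : ℝ → ℝ := fun x => ∑ j : Fin n, if w j ≤ x then |c j.succ - c j.castSucc| else 0 with hΦ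
  have hle : ∀ x y, x ≤ y → |g y - g x| ≤ Φ y - Φ x := by
    intro x y hxy
    rw [hg.eq_sum hw x, hg.eq_sum hw y, hΦ]
    dsimp only
    rw [add_sub_add_left_eq_sub, ← Finset.sum_sub_distrib, ← Finset.sum_sub_distrib]
    refine (Finset.abs_sum_le_sum_abs _ _).trans (Finset.sum_le_sum fun j _ => ?_)
    by_cases h1 : w j ≤ x
    · simp [h1, h1.trans hxy]
    · by_cases h2 : w j ≤ y <;> simp [h1, h2]
  have hΦ0 : ∀ x, 0 ≤ Φ x := fun x => Finset.sum_nonneg fun j _ => by split_ifs <;> positivity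
  have hΦ1 : ∀ x, Φ x ≤ ∑ j : Fin n, |c j.succ - c j.castSucc| := fun x =>
    Finset.sum_le_sum fun j _ => by split_ifs <;> first | exact le_rfl | positivity
  refine iSup_le fun ⟨N, v, hv, _⟩ => ?_
  have hstep : ∀ i, |g (v (i + 1)) - g (v i)| ≤ Φ (v (i + 1)) - Φ (v i) := fun i =>
    hle _ _ (hv (Nat.le_succ i))
  calc ∑ i ∈ Finset.range N, edist (g (v (i + 1))) (g (v i))
      ≤ ∑ i ∈ Finset.range N, ENNReal.ofReal (Φ (v (i + 1)) - Φ (v i)) :=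
        Finset.sum_le_sum fun i _ => by
          rw [edist_dist, Real.dist_eq]; exact ENNReal.ofReal_le_ofReal (hstep i)
    _ = ENNReal.ofReal (Φ (v N) - Φ (v 0)) := by
        rw [← ENNReal.ofReal_sum_of_nonneg fun i _ => (abs_nonneg _).trans (hstep i),
          Finset.sum_range_sub fun i => Φ (v i)]
    _ ≤ _ := ENNReal.ofReal_le_ofReal (by linarith [hΦ0 (v 0), hΦ1 (v N)])

theorem ofReal_sum_abs_le_eVariationOn (g : ℝ → ℝ) (x : Fin (n + 1) → ℝ) (hx : Monotone x) :
    ENNReal.ofReal (∑ j : Fin n, |g (x j.succ) - g (x j.castSucc)|) ≤ eVariationOn g univ := by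
  set v : ℕ → ℝ := fun k => x ⟨min k n, by omega⟩ with hv
  have hvm : Monotone v := fun a b hab => hx (by simp only [Fin.le_def]; omega)
  refine le_trans (le_of_eq ?_) (eVariationOn.sum_le (n := n) hvm fun i => mem_univ _)
  rw [ENNReal.ofReal_sum_of_nonneg fun _ _ => abs_nonneg _,
    ← Fin.sum_univ_eq_sum_range fun i => edist (g (v (i + 1))) (g (v i))]
  refine Finset.sum_congr rfl fun j _ => ?_
  have h1 : v (j + 1) = x j.succ := congrArg x (Fin.ext (by simp))
  have h2 : v j = x j.castSucc := congrArg x (Fin.ext (by simp))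
  rw [h1, h2, edist_dist, Real.dist_eq]

/-- If the jumps at coinciding positions all have the same sign, then no variation is hidden. -/
theorem IsStep.le_eVariationOn (hw : Monotone w) (hg : IsStep g w c)
    (hfan : ∀ i j, w i = w j → 0 < (c i.succ - c i.castSucc) * (c j.succ - c j.castSucc)) :
    ENNReal.ofReal (∑ j : Fin n, |c j.succ - c j.castSucc|) ≤ eVariationOn g univ := by
  obtain ⟨R, hR⟩ := (Set.finite_range w).bddBelow
  have hR' : ∀ j, R ≤ w j := fun j => hR ⟨j, rfl⟩
  -- Sample once to the left of all positions, then at each position.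
  set x : Fin (n + 1) → ℝ := Fin.cons (R - 1) w with hx
  have hxm : Monotone x := by
    intro a b hab
    rcases Fin.eq_zero_or_eq_succ a with rfl | ⟨i, rfl⟩ <;>
      rcases Fin.eq_zero_or_eq_succ b with rfl | ⟨j, rfl⟩
    · exact le_rfl
    · simp only [hx, Fin.cons_zero, Fin.cons_succ]; linarith [hR' j]
    · simp at hab
    · simpa [hx] using hw (Fin.succ_le_succ_iff.mp hab)
  refine le_trans (ENNReal.ofReal_le_ofReal ?_) (ofReal_sum_abs_le_eVariationOn g x hxm)
  set s : Fin n → ℝ := fun j => if 0 ≤ c j.succ - c j.castSucc then 1 else -1 with hs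
  -- At a cluster of coinciding positions `g` only shows the state after the last one. The error `E`
  -- made there vanishes at the end of each cluster, and the sign `s` is constant on a cluster, so
  -- the signed errors telescope to zero.
  set E : Fin (n + 1) → ℝ := fun i => g (x i) - c i with hE
  set H : Fin (n + 1) → ℝ := Fin.cons 0 fun j => s j * E j.succ with hH
  have hE0 : E 0 = 0 := by
    rw [hE]; dsimp only
    rw [hg.eq_first (x := x 0) fun j => by simp only [hx, Fin.cons_zero]; linarith [hR' j], sub_self]
  have hHs : ∀ j, H j.succ = s j * E j.succ := fun j => by rw [hH, Fin.cons_succ]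
  have hEs : ∀ i : Fin n, (∀ j : Fin n, i.succ ≤ j.castSucc → w i < w j) → E i.succ = 0 := by
    intro i hi
    rw [hE]; dsimp only
    rw [hx, Fin.cons_succ, hg (w i) i.succ (fun l hl => hw ?_) hi, sub_self]
    simp only [Fin.lt_def, Fin.le_def, Fin.val_castSucc, Fin.val_succ] at hl ⊢
    omega
  have hlast : H (Fin.last n) = 0 := by
    rcases Fin.eq_zero_or_eq_succ (Fin.last n) with h | ⟨i, h⟩
    · rw [h, hH, Fin.cons_zero]
    · rw [h, hHs, hEs i, mul_zero]
      intro j hj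
      rw [← h] at hj
      exact absurd (Fin.castSucc_lt_last j) (not_lt.mpr hj)
  have hcast : ∀ j : Fin n, s j * E j.castSucc = H j.castSucc := by
    intro j
    rcases Fin.eq_zero_or_eq_succ j.castSucc with h | ⟨i, h⟩
    · rw [h, hE0, mul_zero, hH, Fin.cons_zero]
    · rw [h, hHs]
      have hij : i ≤ j := by
        have := congrArg Fin.val h
        simp only [Fin.le_def, Fin.val_castSucc, Fin.val_succ] at this ⊢
        omega
      rcases (hw hij).lt_or_eq with hlt | heq
      · rw [hEs i fun l hl => ?_, mul_zero, mul_zero]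
        rw [← h, Fin.castSucc_le_castSucc_iff] at hl
        exact hlt.trans_le (hw hl)
      · have := hfan i j heq
        have hsij : s i = s j := by
          simp only [hs]
          rcases pos_and_pos_or_neg_and_neg_of_mul_pos this with ⟨h1, h2⟩ | ⟨h1, h2⟩
          · rw [if_pos h1.le, if_pos h2.le]
          · rw [if_neg h1.not_ge, if_neg h2.not_ge]
        rw [hsij]
  have hsabs : ∀ j, |s j| = 1 := fun j => by simp only [hs]; split_ifs <;> simp
  calc ∑ j : Fin n, |c j.succ - c j.castSucc|
      = ∑ j : Fin n, s j * (c j.succ - c j.castSucc) := Finset.sum_congr rfl fun j _ => by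
        simp only [hs]
        split_ifs with h
        · rw [abs_of_nonneg h, one_mul]
        · rw [abs_of_neg (not_le.mp h), neg_one_mul]
    _ = ∑ j : Fin n, (s j * (g (x j.succ) - g (x j.castSucc)) - (H j.succ - H j.castSucc)) :=
        Finset.sum_congr rfl fun j _ => by rw [← hcast, hHs, hE]; ring
    _ = ∑ j : Fin n, s j * (g (x j.succ) - g (x j.castSucc)) := by
        rw [Finset.sum_sub_distrib, sum_succ_sub, hlast, hH, Fin.cons_zero, sub_zero, sub_zero]
    _ ≤ _ := Finset.sum_le_sum fun j _ => by
        refine (le_abs_self _).trans (le_of_eq ?_)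
        rw [abs_mul, hsabs, one_mul]

end

end FrontTracking

namespace FrontTracking

/-! ### The balance across a single front -/

/-- A discontinuity of speed `σ` between the states `l` and `r`, possibly trivial, which satisfies
the Rankine-Hugoniot relation, and which is entropy admissible or of strength at most `h`. -/
def IsWeakFront (f : ℝ → ℝ) (h σ l r : ℝ) : Prop :=
  σ * (r - l) = f r - f l ∧ (Oleinik f l r ∨ |r - l| ≤ h)

theorem contDiff_one_deriv {f : ℝ → ℝ} (hf : ContDiff ℝ 2 f) : ContDiff ℝ 1 (deriv f) := by
  rw [← one_add_one_eq_two] at hf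
  exact (contDiff_succ_iff_deriv.mp hf).2.2

/-- By `hvio` the chord from `l` to `w` has slope below σ, which contradicts the Oleinik inequality;
so the jump is at most `h`. Both slopes are values of f' on the segment, hence differ by at most `M
* h`. -/
theorem chord_le {f : ℝ → ℝ} (hf : ContDiff ℝ 2 f) {h σ l r w M : ℝ} (hF : IsWeakFront f h σ l r)
    (hM : ∀ z ∈ segment ℝ l r, |deriv (deriv f) z| ≤ M) (hw : l < w ∧ w < r ∨ r < w ∧ w < l)
    (hvio : (r - l) * ((f w - σ * w) - (f l - σ * l)) < 0) :
    |(f w - σ * w) - (f l - σ * l)| ≤ h * M * |r - l| := by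
  have hd : Differentiable ℝ f := hf.differentiable (by norm_num)
  have hd' : Differentiable ℝ (deriv f) := (contDiff_one_deriv hf).differentiable one_ne_zero
  obtain ⟨hRH, hF⟩ := hF
  have hrl : r - l ≠ 0 := by rcases hw with hw | hw <;> intro h0 <;> linarith
  have hwl : w - l ≠ 0 := by rcases hw with hw | hw <;> intro h0 <;> linarith
  have hσ : (f r - f l) / (r - l) = σ := by rw [← hRH]; field_simp
  have hsmall : |r - l| ≤ h := by
    refine hF.resolve_left fun hO => ?_
    have := hO w hw
    rw [hσ] at this
    rcases hw with hw | hw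
    · rw [le_div_iff₀ (by linarith)] at this
      nlinarith
    · rw [le_div_iff_of_neg (by linarith)] at this
      nlinarith
  have hM0 : 0 ≤ M := (abs_nonneg _).trans (hM l (left_mem_segment ℝ l r))
  have mvt : ∀ z, z ≠ l → z ∈ segment ℝ l r →
      ∃ ξ ∈ segment ℝ l r, deriv f ξ = (f z - f l) / (z - l) := by
    intro z hz hzs
    have hsub : segment ℝ l z ⊆ segment ℝ l r :=
      (convex_segment l r).segment_subset (left_mem_segment ℝ l r) hzs
    rcases lt_or_gt_of_ne hz with hlt | hlt
    · obtain ⟨ξ, hξ, e⟩ := exists_deriv_eq_slope f hlt hd.continuous.continuousOn hd.differentiableOn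
      refine ⟨ξ, hsub ?_, ?_⟩
      · rw [segment_symm, segment_eq_Icc hlt.le]; exact Ioo_subset_Icc_self hξ
      · rw [e, ← neg_sub, ← neg_sub z l, neg_div_neg_eq]
    · obtain ⟨ξ, hξ, e⟩ := exists_deriv_eq_slope f hlt hd.continuous.continuousOn hd.differentiableOn
      refine ⟨ξ, hsub ?_, e⟩
      rw [segment_eq_Icc hlt.le]; exact Ioo_subset_Icc_self hξ
  have hws : w ∈ segment ℝ l r := by
    rcases hw with hw | hw
    · rw [segment_eq_Icc (hw.1.trans hw.2).le]; exact ⟨hw.1.le, hw.2.le⟩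
    · rw [segment_symm, segment_eq_Icc (hw.1.trans hw.2).le]; exact ⟨hw.1.le, hw.2.le⟩
  obtain ⟨ξ, hξ, eξ⟩ := mvt w (sub_ne_zero.mp hwl) hws
  obtain ⟨η, hη, eη⟩ := mvt r (sub_ne_zero.mp hrl) (right_mem_segment ℝ l r)
  rw [hσ] at eη
  have hlip := Convex.norm_image_sub_le_of_norm_deriv_le (f := deriv f) (fun z _ => hd' z) hM
    (convex_segment l r) hη hξ
  have hdist : ∀ p ∈ segment ℝ l r, ∀ q ∈ segment ℝ l r, |p - q| ≤ |r - l| := by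
    intro p hp q hq
    rw [segment_eq_uIcc] at hp hq
    exact abs_sub_le_of_uIcc_subset_uIcc (uIcc_subset_uIcc hq hp)
  rw [Real.norm_eq_abs, Real.norm_eq_abs, eξ, eη] at hlip
  have heq : (f w - σ * w) - (f l - σ * l) = ((f w - f l) / (w - l) - σ) * (w - l) := by
    field_simp; ring
  rw [heq, abs_mul]
  calc |(f w - f l) / (w - l) - σ| * |w - l|
      ≤ (M * h) * |r - l| :=
        mul_le_mul
          (hlip.trans (mul_le_mul_of_nonneg_left ((hdist _ hξ _ hη).trans hsmall) hM0))
          (hdist _ hws _ (left_mem_segment ℝ l r)) (abs_nonneg _)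
          (mul_nonneg hM0 ((abs_nonneg _).trans hsmall))
    _ = h * M * |r - l| := by ring

/-- The bound on the growth at a rarefaction of the averaging coefficient, for
`U < V` and `V' < U'`. -/
theorem rarefaction_le_of_lt {f : ℝ → ℝ} (hf : ContDiff ℝ 2 f) {h σ U U' V V' M : ℝ}
    (hh : 0 ≤ h) (hU : IsWeakFront f h σ U U') (hV : IsWeakFront f h σ V V')
    (hMU : ∀ z ∈ segment ℝ U U', |deriv (deriv f) z| ≤ M)
    (hMV : ∀ z ∈ segment ℝ V V', |deriv (deriv f) z| ≤ M)
    (h1 : U < V) (h2 : V' < U') (hq : f V - σ * V < f U - σ * U) :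
    |(f V - σ * V) - (f U - σ * U)| ≤ h * M * (|U' - U| + |V' - V|) := by
  have hM0 : 0 ≤ M := (abs_nonneg _).trans (hMU U (left_mem_segment ℝ U U'))
  have eU : f U' - σ * U' = f U - σ * U := by linarith [hU.1]
  have eV : f V' - σ * V' = f V - σ * V := by linarith [hV.1]
  have hUn : 0 ≤ h * M * |U' - U| := by positivity
  have hVn : 0 ≤ h * M * |V' - V| := by positivity
  have viaV : V' < U → |(f V - σ * V) - (f U - σ * U)| ≤ h * M * (|U' - U| + |V' - V|) := by
    intro h3
    have := chord_le hf hV hMV (w := U) (Or.inr ⟨h3, h1⟩) (by nlinarith)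
    rw [abs_sub_comm] at this
    linarith
  -- The function z ↦ f z - σ z takes one value at `U`, `U'` and a smaller one at `V`, `V'`.
  -- Depending on the order, `V` or `V'` lies inside the jump of the first solution, or `U` inside
  -- that of the second.
  rcases lt_or_ge U U' with h3 | h3
  · rcases lt_or_ge V U' with h4 | h4
    · have := chord_le hf hU hMU (w := V) (Or.inl ⟨h1, h4⟩) (by nlinarith)
      linarith
    · rcases lt_or_ge U V' with h5 | h5
      · have := chord_le hf hU hMU (w := V') (Or.inl ⟨h5, h2⟩) (by rw [eV]; nlinarith)
        rw [eV] at this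
        linarith
      · refine viaV (lt_of_le_of_ne h5 fun h6 => ?_)
        rw [h6] at eV; linarith
  · exact viaV (h2.trans_le h3)

open Classical in
/-- The dissipation at a front of speed `σ`, with strength `G` of the left-hand trace, across which
the averaging coefficient changes from `a` to `a'`. -/
noncomputable def laxTerm (a a' σ G : ℝ) : ℝ :=
  if a' < σ ∧ σ < a then 2 * (a - σ) * |G| else 0

theorem laxTerm_nonneg (a a' σ G : ℝ) : 0 ≤ laxTerm a a' σ G := by
  unfold laxTerm
  split_ifs with h
  · have : 0 < a - σ := by linarith [h.2]
    positivity
  · exact le_rfl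

/-- Both (a - σ)(V - U) and its right-hand analogue equal the same Q, so only the signs of a - σ and
a' - σ matter. -/
theorem front_balance {f : ℝ → ℝ} (hf : ContDiff ℝ 2 f) {h σ U U' V V' M : ℝ}
    (hh : 0 ≤ h) (hU : IsWeakFront f h σ U U') (hV : IsWeakFront f h σ V V')
    (hMU : ∀ z ∈ segment ℝ U U', |deriv (deriv f) z| ≤ M)
    (hMV : ∀ z ∈ segment ℝ V V', |deriv (deriv f) z| ≤ M) :
    σ * (|V - U| - |V' - U'|) + laxTerm (dslope f U V) (dslope f U' V') σ (V - U)
      ≤ dslope f U V * |V - U| - dslope f U' V' * |V' - U'|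
        + 2 * h * M * (|U' - U| + |V' - V|) := by
  have hM0 : 0 ≤ M := (abs_nonneg _).trans (hMU U (left_mem_segment ℝ U U'))
  have e : (V - U) * dslope f U V = f V - f U := by simpa using sub_smul_dslope f U V
  have e' : (V' - U') * dslope f U' V' = f V' - f U' := by simpa using sub_smul_dslope f U' V'
  set a := dslope f U V
  set a' := dslope f U' V'
  have hQ : (a - σ) * (V - U) = (f V - σ * V) - (f U - σ * U) := by linarith
  have hQ' : (a' - σ) * (V' - U') = (f V - σ * V) - (f U - σ * U) := by linarith [hU.1, hV.1]
  have hK : 0 ≤ h * M * (|U' - U| + |V' - V|) := by positivity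
  have hX : |a - σ| * |V - U| = |(f V - σ * V) - (f U - σ * U)| := by rw [← abs_mul, hQ]
  have hY : |a' - σ| * |V' - U'| = |(f V - σ * V) - (f U - σ * U)| := by rw [← abs_mul, hQ']
  suffices hs : -((a - σ) * |V - U|) + (a' - σ) * |V' - U'| + laxTerm a a' σ (V - U)
      ≤ 2 * (h * M * (|U' - U| + |V' - V|)) by linarith
  unfold laxTerm
  rcases le_or_gt a' σ with ha' | ha'
  · rw [abs_of_nonpos (by linarith)] at hY
    rcases le_or_gt a σ with ha | ha
    · rw [abs_of_nonpos (by linarith)] at hX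
      rw [if_neg (by intro h; linarith [h.2])]
      linarith
    · rw [abs_of_pos (by linarith)] at hX
      have : 0 ≤ (a - σ) * |V - U| := by rw [hX]; positivity
      split_ifs <;> linarith
  · rw [abs_of_pos (by linarith)] at hY
    rw [if_neg (by intro h; linarith [h.1])]
    rcases le_or_gt σ a with ha | ha
    · rw [abs_of_nonneg (by linarith)] at hX
      linarith
    · rw [abs_of_neg (by linarith)] at hX
      suffices hs : |(f V - σ * V) - (f U - σ * U)| ≤ h * M * (|U' - U| + |V' - V|) by linarith
      -- As a - σ < 0 < a' - σ and Q is common to both sides, V - U and V' - U' have opposite signs.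
      -- The two orders are exchanged by swapping the solutions.
      rcases lt_trichotomy U V with hUV | hUV | hUV
      · have hneg : (f V - σ * V) - (f U - σ * U) < 0 := by
          rw [← hQ]; exact mul_neg_of_neg_of_pos (by linarith) (by linarith)
        have h2 : V' < U' := by
          by_contra hc
          have := mul_nonneg (by linarith : 0 ≤ a' - σ) (by linarith : 0 ≤ V' - U')
          linarith
        exact rarefaction_le_of_lt hf hh hU hV hMU hMV hUV h2 (by linarith)
      · rw [hUV, sub_self, abs_zero]; rwa [hUV] at hK
      · have hpos : 0 < (f V - σ * V) - (f U - σ * U) := by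
          rw [← hQ]; exact mul_pos_of_neg_of_neg (by linarith) (by linarith)
        have h2 : U' < V' := by
          by_contra hc
          have := mul_nonneg (by linarith : 0 ≤ a' - σ) (by linarith : 0 ≤ U' - V')
          linarith
        rw [abs_sub_comm, add_comm]
        exact rarefaction_le_of_lt hf hh hV hU hMV hMU hUV h2 (by linarith)

end FrontTracking

namespace FrontTracking

/-! ### Strips with possibly trivial fronts, and their common refinements -/

/-- The position at time `t` on the line `p = (y, σ)` of initial position `y` and speed `σ`. -/
def lineAt (p : ℝ × ℝ) (t : ℝ) : ℝ := p.1 + p.2 * t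

theorem continuous_lineAt (p : ℝ × ℝ) : Continuous (lineAt p) := by
  unfold lineAt; fun_prop

/-- For times in `[α, β]`, `u` is piecewise constant, with jumps (possibly trivial) along
the lines `p j`, which do not meet for times in `(α, β)`. -/
structure IsWeakStrip (f : ℝ → ℝ) (h : ℝ) (u : ℝ → ℝ → ℝ) (α β : ℝ) {n : ℕ}
    (p : Fin n → ℝ × ℝ) (c : Fin (n + 1) → ℝ) : Prop where
  ordered : ∀ t ∈ Ioo α β, StrictMono fun j => lineAt (p j) t
  step : ∀ t ∈ Icc α β, IsStep (fun x => u x t) (fun j => lineAt (p j) t) c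
  front : ∀ j, IsWeakFront f h (p j).2 (c j.castSucc) (c j.succ)

section

variable {f : ℝ → ℝ} {h : ℝ} {u : ℝ → ℝ → ℝ} {α β : ℝ} {n : ℕ}
  {p : Fin n → ℝ × ℝ} {c : Fin (n + 1) → ℝ}

/-- Lines may meet at the end times; the weak order survives there by continuity. -/
theorem monotone_lineAt_of_strictMono (hαβ : α < β)
    (hp : ∀ t ∈ Ioo α β, StrictMono fun j => lineAt (p j) t) {t : ℝ} (ht : t ∈ Icc α β) :
    Monotone fun j => lineAt (p j) t := by
  intro i j hij
  have hcl : IsClosed {t | lineAt (p i) t ≤ lineAt (p j) t} :=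
    isClosed_le (continuous_lineAt _) (continuous_lineAt _)
  have hsub : Ioo α β ⊆ {t | lineAt (p i) t ≤ lineAt (p j) t} := fun s hs => (hp s hs).monotone hij
  rw [← closure_Ioo hαβ.ne] at ht
  exact hcl.closure_subset_iff.mpr hsub ht

theorem IsWeakStrip.mono {α' β' : ℝ} (hu : IsWeakStrip f h u α β p c) (hα : α ≤ α') (hβ : β' ≤ β) :
    IsWeakStrip f h u α' β' p c :=
  ⟨fun t ht => hu.ordered t (Ioo_subset_Ioo hα hβ ht), fun t ht => hu.step t (Icc_subset_Icc hα hβ ht),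
    hu.front⟩

theorem IsFrontStrip.isWeakStrip {τ : ℝ} {I : Set ℝ} {y σ : Fin n → ℝ}
    (hu : IsFrontStrip f h u τ I y σ c) (hI : Icc α β ⊆ I) :
    IsWeakStrip f h u α β (fun j => (y j - σ j * τ, σ j)) c := by
  have key : ∀ j t, lineAt (y j - σ j * τ, σ j) t = y j + σ j * (t - τ) := fun j t => by
    unfold lineAt; ring
  refine ⟨fun t ht => ?_, fun t ht => ?_, fun j => ⟨hu.rankineHugoniot j, hu.shock_or_small j⟩⟩
  · simp only [key]
    exact hu.ordered t (interior_maximal (Ioo_subset_Icc_self.trans hI) isOpen_Ioo ht)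
  · simp only [key]
    exact hu.value t (hI ht)

theorem IsStep.exists_eq {g : ℝ → ℝ} {w : Fin n → ℝ} (hg : IsStep g w c) (hw : StrictMono w)
    (i : Fin (n + 1)) : ∃ x, g x = c i := by
  rcases Fin.eq_zero_or_eq_succ i with rfl | ⟨j, rfl⟩
  · obtain ⟨R, hR⟩ := (Set.finite_range w).bddBelow
    exact ⟨R - 1, hg.eq_first fun j => by linarith [hR ⟨j, rfl⟩]⟩
  · exact ⟨w j, hg _ _ (fun l hl => hw.monotone (Fin.castSucc_lt_succ_iff.mp hl))
      fun l hl => hw (Fin.succ_le_castSucc_iff.mp hl)⟩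

/-- Sort by position at one interior time. By the intermediate value theorem the order could change
only through a meeting, which is excluded. -/
theorem exists_sorted_lines (L : Finset (ℝ × ℝ)) (hαβ : α < β)
    (hL : ∀ p ∈ L, ∀ q ∈ L, ∀ t ∈ Ioo α β, lineAt p t = lineAt q t → p = q) :
    ∃ (k : ℕ) (q : Fin k → ℝ × ℝ), (∀ p ∈ L, ∃ i, q i = p) ∧
      ∀ t ∈ Ioo α β, StrictMono fun j => lineAt (q j) t := by
  classical
  obtain ⟨m, hm⟩ : (Ioo α β).Nonempty := nonempty_Ioo.mpr hαβ
  set P := L.image fun p => lineAt p m with hP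
  set φ := P.orderEmbOfFin rfl with hφ
  have hrange : range φ = (P : Set ℝ) := P.range_orderEmbOfFin rfl
  have hex : ∀ i, ∃ p ∈ L, lineAt p m = φ i := fun i => by
    have : φ i ∈ (P : Set ℝ) := hrange ▸ mem_range_self i
    simpa [hP] using this
  choose q hqL hq using hex
  refine ⟨_, q, fun p hp => ?_, fun t ht i j hij => ?_⟩
  · have : lineAt p m ∈ (P : Set ℝ) := by
      rw [hP]; exact Finset.mem_coe.mpr (Finset.mem_image_of_mem _ hp)
    rw [← hrange] at this
    obtain ⟨i, hi⟩ := this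
    exact ⟨i, hL _ (hqL i) _ hp m hm ((hq i).trans hi)⟩
  · have hlt : lineAt (q i) m < lineAt (q j) m := by rw [hq, hq]; exact φ.strictMono hij
    by_contra hcon
    have hcon : lineAt (q j) t ≤ lineAt (q i) t := not_lt.mp hcon
    have hc : Continuous fun s => lineAt (q j) s - lineAt (q i) s :=
      (continuous_lineAt _).sub (continuous_lineAt _)
    obtain ⟨s, hs, hs0⟩ := intermediate_value_uIcc (hc.continuousOn (s := uIcc t m))
      (show (0 : ℝ) ∈ _ from mem_uIcc.mpr (Or.inl ⟨by linarith, by linarith⟩))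
    have hs' : s ∈ Ioo α β := ordConnected_Ioo.uIcc_subset ht hm hs
    have := hL _ (hqL j) _ (hqL i) s hs' (sub_eq_zero.mp hs0)
    rw [this] at hlt
    exact lt_irrefl _ hlt

theorem threshold_unique {e e' : Fin (n + 1)}
    (H : ∀ j : Fin n, j.castSucc < e ↔ j.castSucc < e') : e = e' := by
  rcases lt_trichotomy e e' with hlt | heq | hlt
  · have := (H (e.castPred (ne_of_lt (hlt.trans_le (Fin.le_last _))))).mpr (by simpa using hlt)
    simp at this
  · exact heq
  · have := (H (e'.castPred (ne_of_lt (hlt.trans_le (Fin.le_last _))))).mp (by simpa using hlt)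
    simp at this

theorem IsWeakFront.refl (f : ℝ → ℝ) (hh : 0 ≤ h) (σ l : ℝ) : IsWeakFront f h σ l l :=
  ⟨by simp, Or.inr (by simpa using hh)⟩

/-- A strip may be refined by adding trivial fronts. -/
theorem IsWeakStrip.refine (hh : 0 ≤ h) (hαβ : α < β) (hu : IsWeakStrip f h u α β p c) {k : ℕ}
    (q : Fin k → ℝ × ℝ) (hq : ∀ t ∈ Ioo α β, StrictMono fun j => lineAt (q j) t)
    (hpq : ∀ i, ∃ b, q b = p i) :
    ∃ c' : Fin (k + 1) → ℝ, IsWeakStrip f h u α β q c' ∧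
      ∑ b : Fin k, |c' b.succ - c' b.castSucc| = ∑ i : Fin n, |c i.succ - c i.castSucc| := by
  choose a ha using hpq
  obtain ⟨m, hm⟩ : (Ioo α β).Nonempty := nonempty_Ioo.mpr hαβ
  have hamono : StrictMono a := fun i j hij => by
    have := hu.ordered m hm hij
    simp only [← ha] at this
    exact (hq m hm).lt_iff_lt.mp this
  -- `e b` is the number of original lines to the left of the refined cell `b`; it does not change
  -- across an added line.
  have hex : ∀ b : Fin (k + 1), ∃ e : Fin (n + 1), ∀ i, i.castSucc < e ↔ (a i).castSucc < b :=
    fun b => exists_threshold (fun i => (a i).castSucc < b) fun i j hij hj =>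
      lt_of_le_of_lt (Fin.castSucc_le_castSucc_iff.mpr (hamono.monotone hij)) hj
  choose e he using hex
  have e_left : ∀ i, e (a i).castSucc = i.castSucc := fun i => threshold_unique fun j => by
    rw [he, Fin.castSucc_lt_castSucc_iff, Fin.castSucc_lt_castSucc_iff, hamono.lt_iff_lt]
  have e_right : ∀ i, e (a i).succ = i.succ := fun i => threshold_unique fun j => by
    rw [he, Fin.castSucc_lt_succ_iff, Fin.castSucc_lt_succ_iff, hamono.le_iff_le]
  have e_none : ∀ b, b ∉ range a → e b.castSucc = e b.succ := fun b hb => threshold_unique fun j => by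
    rw [he, he, Fin.castSucc_lt_castSucc_iff, Fin.castSucc_lt_succ_iff]
    exact ⟨le_of_lt, fun hle => lt_of_le_of_ne hle fun heq => hb ⟨j, heq⟩⟩
  refine ⟨fun b => c (e b), ⟨hq, fun t ht x b h1 h2 => ?_, fun b => ?_⟩, ?_⟩
  · refine hu.step t ht x (e b) (fun i hi => ?_) fun i hi => ?_
    · have := h1 (a i) ((he b i).mp hi)
      simpa only [ha] using this
    · have := h2 (a i) (not_lt.mp fun hlt => absurd ((he b i).mpr hlt) (not_lt.mpr hi))
      simpa only [ha] using this
  · by_cases hb : b ∈ range a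
    · obtain ⟨i, rfl⟩ := hb
      simp only [e_left, e_right, ha]
      exact hu.front i
    · simp only [e_none b hb]
      exact IsWeakFront.refl f hh _ _
  · symm
    refine Fintype.sum_of_injective a hamono.injective _ _ (fun b hb => ?_) fun i => ?_
    · simp only [e_none b hb, sub_self, abs_zero]
    · simp only [e_left, e_right]

end

end FrontTracking

namespace FrontTracking

/-! ### Local structure away from the interaction times -/

section

variable {g : ℝ → ℝ → ℝ} {x t σ l r : ℝ}

/-- Near `(x, t)`, `g` is equal to `l` on the left, and to `r` on the right, of the line of speed `σ`
through `(x, t)`. -/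
def HasSides (g : ℝ → ℝ → ℝ) (x t σ l r : ℝ) : Prop :=
  ∀ᶠ p : ℝ × ℝ in 𝓝 (x, t),
    (p.1 < x + σ * (p.2 - t) → g p.1 p.2 = l) ∧ (x + σ * (p.2 - t) < p.1 → g p.1 p.2 = r)

theorem HasSides.leftTrace_eq (H : HasSides g x t σ l r) : leftTrace g x t = l := by
  have hc : Tendsto (fun y : ℝ => (y, t)) (𝓝 x) (𝓝 (x, t)) := by
    have : Continuous fun y : ℝ => (y, t) := by fun_prop
    exact this.tendsto x
  refine leftLim_eq_of_tendsto (tendsto_const_nhds.congr' ?_)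
  filter_upwards [(hc.eventually H).filter_mono nhdsWithin_le_nhds, self_mem_nhdsWithin] with y hy hyx
  exact (hy.1 (by simpa using hyx)).symm

theorem HasSides.rightTrace_eq (H : HasSides g x t σ l r) : rightTrace g x t = r := by
  have hc : Tendsto (fun y : ℝ => (y, t)) (𝓝 x) (𝓝 (x, t)) := by
    have : Continuous fun y : ℝ => (y, t) := by fun_prop
    exact this.tendsto x
  refine rightLim_eq_of_tendsto (tendsto_const_nhds.congr' ?_)
  filter_upwards [(hc.eventually H).filter_mono nhdsWithin_le_nhds, self_mem_nhdsWithin] with y hy hyx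
  exact (hy.2 (by simpa using hyx)).symm

theorem HasSides.jumpSpeed_eq (H : HasSides g x t σ l r) (hlr : l ≠ r) : jumpSpeed g x t = σ := by
  have hex : ∃ σ, IsJumpWithSpeed g x t σ := ⟨σ, l, r, hlr, H⟩
  rw [jumpSpeed, dif_pos hex]
  exact hex.choose_spec.unique ⟨l, r, hlr, H⟩

variable {α β : ℝ} {n : ℕ} {q : Fin n → ℝ × ℝ} {c : Fin (n + 1) → ℝ}

theorem hasSides_of_front (hq : ∀ t ∈ Ioo α β, StrictMono fun j => lineAt (q j) t)
    (hg : ∀ t ∈ Icc α β, IsStep (fun x => g x t) (fun j => lineAt (q j) t) c) (ht : t ∈ Ioo α β)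
    {b : Fin n} (hb : lineAt (q b) t = x) :
    HasSides g x t (q b).2 (c b.castSucc) (c b.succ) := by
  have hc : ∀ j, Continuous fun p : ℝ × ℝ => lineAt (q j) p.2 := fun j =>
    (continuous_lineAt _).comp continuous_snd
  have h1 : ∀ᶠ p : ℝ × ℝ in 𝓝 (x, t), p.2 ∈ Ioo α β :=
    continuous_snd.continuousAt.eventually (isOpen_Ioo.mem_nhds ht)
  have h2 : ∀ᶠ p : ℝ × ℝ in 𝓝 (x, t), ∀ j, j < b → lineAt (q j) p.2 < p.1 := by
    refine eventually_all.mpr fun j => ?_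
    by_cases hj : j < b
    · filter_upwards [((hc j).continuousAt.eventually_lt continuous_fst.continuousAt
        (by dsimp only; rw [← hb]; exact hq t ht hj))] with p hp _ using hp
    · exact Eventually.of_forall fun p h => absurd h hj
  have h3 : ∀ᶠ p : ℝ × ℝ in 𝓝 (x, t), ∀ j, b < j → p.1 < lineAt (q j) p.2 := by
    refine eventually_all.mpr fun j => ?_
    by_cases hj : b < j
    · filter_upwards [(continuous_fst.continuousAt.eventually_lt (hc j).continuousAt
        (by dsimp only; rw [← hb]; exact hq t ht hj))] with p hp _ using hp
    · exact Eventually.of_forall fun p h => absurd h hj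
  filter_upwards [h1, h2, h3] with p hp1 hp2 hp3
  have hline : x + (q b).2 * (p.2 - t) = lineAt (q b) p.2 := by rw [← hb]; unfold lineAt; ring
  rw [hline]
  have hst := hg p.2 (Ioo_subset_Icc_self hp1)
  refine ⟨fun hlt => hst p.1 b.castSucc (fun j hj => ?_) fun j hj => ?_,
    fun hlt => hst p.1 b.succ (fun j hj => ?_) fun j hj => ?_⟩
  · exact (hp2 j (Fin.castSucc_lt_castSucc_iff.mp hj)).le
  · rcases (Fin.castSucc_le_castSucc_iff.mp hj).eq_or_lt with rfl | hbj
    · exact hlt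
    · exact hp3 j hbj
  · rcases (Fin.castSucc_lt_succ_iff.mp hj).eq_or_lt with rfl | hbj
    · exact hlt.le
    · exact (hp2 j hbj).le
  · exact hp3 j (Fin.succ_le_castSucc_iff.mp hj)

/-- The speed 0 is a dummy, the two sides being equal. This rules out jumps of the averaging
coefficient off the lines. -/
theorem hasSides_of_no_front (hq : ∀ t ∈ Ioo α β, StrictMono fun j => lineAt (q j) t)
    (hg : ∀ t ∈ Icc α β, IsStep (fun x => g x t) (fun j => lineAt (q j) t) c) (ht : t ∈ Ioo α β)
    (hx : ∀ j, lineAt (q j) t ≠ x) : ∃ l, HasSides g x t 0 l l := by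
  have hc : ∀ j, Continuous fun p : ℝ × ℝ => lineAt (q j) p.2 := fun j =>
    (continuous_lineAt _).comp continuous_snd
  obtain ⟨e, he⟩ := exists_cell (hq t ht).monotone x
  have h1 : ∀ᶠ p : ℝ × ℝ in 𝓝 (x, t), p.2 ∈ Ioo α β :=
    continuous_snd.continuousAt.eventually (isOpen_Ioo.mem_nhds ht)
  have h2 : ∀ᶠ p : ℝ × ℝ in 𝓝 (x, t), ∀ j : Fin n, j.castSucc < e → lineAt (q j) p.2 < p.1 := by
    refine eventually_all.mpr fun j => ?_
    by_cases hj : j.castSucc < e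
    · filter_upwards [((hc j).continuousAt.eventually_lt continuous_fst.continuousAt
        (lt_of_le_of_ne ((he j).mp hj) (hx j)))] with p hp _ using hp
    · exact Eventually.of_forall fun p h => absurd h hj
  have h3 : ∀ᶠ p : ℝ × ℝ in 𝓝 (x, t), ∀ j : Fin n, e ≤ j.castSucc → p.1 < lineAt (q j) p.2 := by
    refine eventually_all.mpr fun j => ?_
    by_cases hj : e ≤ j.castSucc
    · filter_upwards [(continuous_fst.continuousAt.eventually_lt (hc j).continuousAt
        (not_le.mp fun h => hj.not_gt ((he j).mpr h)))] with p hp _ using hp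
    · exact Eventually.of_forall fun p h => absurd h hj
  refine ⟨c e, ?_⟩
  filter_upwards [h1, h2, h3] with p hp1 hp2 hp3
  have := hg p.2 (Ioo_subset_Icc_self hp1) p.1 e (fun j hj => (hp2 j hj).le) hp3
  exact ⟨fun _ => this, fun _ => this⟩

end

/-! ### The balance of the `L¹` distance between interaction times -/

section

variable {f : ℝ → ℝ} {h : ℝ} {u v : ℝ → ℝ → ℝ} {α β : ℝ} {n : ℕ} {q : Fin n → ℝ × ℝ}
  {U V : Fin (n + 1) → ℝ}

/-- Every Lax point at time `τ` sits on a line of the strip, and distinct points on distinct lines,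
so the sum embeds in a finite one independent of `τ`. -/
theorem laxDissipation_le (hu : IsWeakStrip f h u α β q U) (hv : IsWeakStrip f h v α β q V) {τ : ℝ}
    (hτ : τ ∈ Ioo α β) :
    laxDissipation (avgSpeed f u v) u v τ ≤ ∑ b : Fin n, ENNReal.ofReal
      (laxTerm (dslope f (U b.castSucc) (V b.castSucc)) (dslope f (U b.succ) (V b.succ)) (q b).2
        (V b.castSucc - U b.castSucc)) := by
  have ha : ∀ t ∈ Icc α β, IsStep (fun x => avgSpeed f u v x t) (fun j => lineAt (q j) t)
      fun i => dslope f (U i) (V i) := fun t ht =>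
    (hu.step t ht).comp₂ (hv.step t ht) fun a b => dslope f a b
  have key : ∀ x : {x : ℝ // (x, τ) ∈ laxSet (avgSpeed f u v)}, ∃ b, lineAt (q b) τ = x ∧
      2 * (leftTrace (avgSpeed f u v) x τ - jumpSpeed (avgSpeed f u v) x τ)
        * |leftTrace v x τ - leftTrace u x τ|
      = laxTerm (dslope f (U b.castSucc) (V b.castSucc)) (dslope f (U b.succ) (V b.succ)) (q b).2
        (V b.castSucc - U b.castSucc) := by
    rintro ⟨x, -, ⟨σ, l, r, hlr, H⟩, hR, hL⟩
    have H : HasSides (avgSpeed f u v) x τ σ l r := H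
    dsimp only at hR hL ⊢
    by_cases hb : ∃ b, lineAt (q b) τ = x
    · obtain ⟨b, hb⟩ := hb
      have Ha := hasSides_of_front hu.ordered ha hτ hb
      have Hu := hasSides_of_front hu.ordered hu.step hτ hb
      have Hv := hasSides_of_front hv.ordered hv.step hτ hb
      rw [Ha.leftTrace_eq] at hL ⊢
      rw [Ha.rightTrace_eq] at hR
      have hs := Ha.jumpSpeed_eq (hR.trans hL).ne'
      rw [hs] at hL hR ⊢
      exact ⟨b, hb, by rw [Hu.leftTrace_eq, Hv.leftTrace_eq, laxTerm, if_pos ⟨hR, hL⟩]⟩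
    · push Not at hb
      obtain ⟨m, Hm⟩ := hasSides_of_no_front hu.ordered ha hτ hb
      exact absurd ((H.leftTrace_eq.symm.trans Hm.leftTrace_eq).trans
        (Hm.rightTrace_eq.symm.trans H.rightTrace_eq)) hlr
  choose b hb hterm using key
  have hinj : Function.Injective b := fun x y hxy => Subtype.ext (by rw [← hb x, ← hb y, hxy])
  unfold laxDissipation
  simp only [hterm]
  refine (ENNReal.tsum_comp_le_tsum_of_injective hinj fun b => ENNReal.ofReal
      (laxTerm (dslope f (U b.castSucc) (V b.castSucc)) (dslope f (U b.succ) (V b.succ)) (q b).2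
        (V b.castSucc - U b.castSucc))).trans ?_
  rw [tsum_fintype]

theorem l1Dist_eq (hαβ : α < β) (hu : IsWeakStrip f h u α β q U) (hv : IsWeakStrip f h v α β q V)
    {t : ℝ} (ht : t ∈ Icc α β) (h0 : V 0 = U 0) (h1 : V (Fin.last n) = U (Fin.last n)) :
    0 ≤ ∑ j : Fin n, lineAt (q j) t * (|V j.castSucc - U j.castSucc| - |V j.succ - U j.succ|) ∧
    l1Dist u v t = ENNReal.ofReal
      (∑ j : Fin n, lineAt (q j) t * (|V j.castSucc - U j.castSucc| - |V j.succ - U j.succ|)) := by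
  have hst : IsStep (fun x => |v x t - u x t|) (fun j => lineAt (q j) t) fun i => |V i - U i| :=
    (hu.step t ht).comp₂ (hv.step t ht) fun a b => |b - a|
  obtain ⟨hint, hval⟩ := hst.integrable_and_integral (monotone_lineAt_of_strictMono hαβ hu.ordered ht)
    (by rw [h0, sub_self, abs_zero]) (by rw [h1, sub_self, abs_zero])
  rw [← hval]
  refine ⟨integral_nonneg fun x => abs_nonneg _, ?_⟩
  rw [ofReal_integral_eq_lintegral_ofReal hint (Eventually.of_forall fun x => abs_nonneg _), l1Dist,
    eLpNorm_one_eq_lintegral_enorm]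
  simp only [← ofReal_norm, Real.norm_eq_abs]

/-- A nonzero constant difference on a half-line would make the distance infinite. -/
theorem eq_at_ends (hαβ : α < β) (hu : IsWeakStrip f h u α β q U) (hv : IsWeakStrip f h v α β q V)
    (hfin : l1Dist u v α ≠ ∞) : V 0 = U 0 ∧ V (Fin.last n) = U (Fin.last n) := by
  rw [l1Dist, eLpNorm_one_eq_lintegral_enorm] at hfin
  have hα : α ∈ Icc α β := left_mem_Icc.mpr hαβ.le
  obtain ⟨h0, h1⟩ := ((hu.step α hα).comp₂ (hv.step α hα) fun a b => b - a).eq_zero_of_lintegral_ne_top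
    hfin
  exact ⟨sub_eq_zero.mp h0, sub_eq_zero.mp h1⟩

theorem l1Dist_add_le_of_strip (hf : ContDiff ℝ 2 f) (hh : 0 ≤ h) (hαβ : α < β)
    (hu : IsWeakStrip f h u α β q U) (hv : IsWeakStrip f h v α β q V) {C : Set ℝ} (hC : Convex ℝ C)
    (hU : ∀ i, U i ∈ C) (hV : ∀ i, V i ∈ C) :
    l1Dist u v β + ∫⁻ τ in Icc α β, laxDissipation (avgSpeed f u v) u v τ
      ≤ l1Dist u v α + ENNReal.ofReal (2 * h * (β - α)) * (⨆ w ∈ C, ‖deriv (deriv f) w‖ₑ)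
          * ENNReal.ofReal (∑ j : Fin n, |U j.succ - U j.castSucc|
            + ∑ j : Fin n, |V j.succ - V j.castSucc|) := by
  by_cases hfin : l1Dist u v α = ∞
  · rw [hfin, top_add]; exact le_top
  obtain ⟨h0, h1⟩ := eq_at_ends hαβ hu hv hfin
  obtain ⟨hα0, hα⟩ := l1Dist_eq hαβ hu hv (left_mem_Icc.mpr hαβ.le) h0 h1
  obtain ⟨hβ0, hβ⟩ := l1Dist_eq hαβ hu hv (right_mem_Icc.mpr hαβ.le) h0 h1
  -- The supremum of |f''| over `C` may be infinite; on the compact hull of the states, contained in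
  -- `C`, it is a real maximum.
  set K := convexHull ℝ (range U ∪ range V) with hK
  have hKc : IsCompact K :=
    ((Set.finite_range U).union (Set.finite_range V)).isCompact_convexHull ℝ
  have hUK : ∀ i, U i ∈ K := fun i => subset_convexHull ℝ _ (Or.inl ⟨i, rfl⟩)
  have hVK : ∀ i, V i ∈ K := fun i => subset_convexHull ℝ _ (Or.inr ⟨i, rfl⟩)
  have hKC : K ⊆ C := convexHull_min
    (union_subset (range_subset_iff.mpr hU) (range_subset_iff.mpr hV)) hC
  have hcont : Continuous fun w => |deriv (deriv f) w| :=
    ((contDiff_one_deriv hf).continuous_deriv le_rfl).abs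
  obtain ⟨z, hzK, hz⟩ := hKc.exists_isMaxOn ⟨_, hUK 0⟩ hcont.continuousOn
  set M := |deriv (deriv f) z| with hM
  have hMK : ∀ w ∈ K, |deriv (deriv f) w| ≤ M := fun w hw => hz hw
  have hMC : ENNReal.ofReal M ≤ ⨆ w ∈ C, ‖deriv (deriv f) w‖ₑ := by
    refine le_trans (le_of_eq ?_) (le_iSup₂ z (hKC hzK))
    rw [hM, ← Real.norm_eq_abs, ofReal_norm]
  have hKconv : Convex ℝ K := convex_convexHull ℝ _
  set A : Fin (n + 1) → ℝ := fun i => dslope f (U i) (V i) with hA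
  set G : Fin (n + 1) → ℝ := fun i => |V i - U i| with hG
  set ℓ : Fin n → ℝ := fun b => laxTerm (A b.castSucc) (A b.succ) (q b).2 (V b.castSucc - U b.castSucc)
    with hℓ
  have hℓ0 : ∀ b, 0 ≤ ℓ b := fun b => laxTerm_nonneg _ _ _ _
  have hbal : ∑ b : Fin n, (q b).2 * (G b.castSucc - G b.succ) + ∑ b, ℓ b
      ≤ 2 * h * M * (∑ j : Fin n, |U j.succ - U j.castSucc|
            + ∑ j : Fin n, |V j.succ - V j.castSucc|) := by
    have hsum := Finset.sum_le_sum fun b (_ : b ∈ Finset.univ) =>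
      front_balance hf hh (hu.front b) (hv.front b) (M := M)
        (fun w hw => hMK w (hKconv.segment_subset (hUK _) (hUK _) hw))
        (fun w hw => hMK w (hKconv.segment_subset (hVK _) (hVK _) hw))
    -- The flux a |V - U| vanishes in both end cells, so it telescopes to zero.
    have htel := sum_succ_sub fun i => -(A i * G i)
    have e0 : G 0 = 0 := by simp only [hG, h0, sub_self, abs_zero]
    have e1 : G (Fin.last n) = 0 := by simp only [hG, h1, sub_self, abs_zero]
    rw [e0, e1, mul_zero, mul_zero, sub_self] at htel
    have hre : ∑ b : Fin n, (A b.castSucc * G b.castSucc - A b.succ * G b.succ) = 0 := by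
      rw [← htel]; exact Finset.sum_congr rfl fun b _ => by ring
    rw [Finset.sum_add_distrib, Finset.sum_add_distrib, hre, zero_add, ← Finset.mul_sum,
      Finset.sum_add_distrib] at hsum
    exact hsum
  set W := ∑ j : Fin n, |U j.succ - U j.castSucc| + ∑ j : Fin n, |V j.succ - V j.castSucc| with hW
  have hW0 : 0 ≤ W := by positivity
  have hdiff : ∑ j : Fin n, lineAt (q j) β * (G j.castSucc - G j.succ)
      = ∑ j : Fin n, lineAt (q j) α * (G j.castSucc - G j.succ)
        + (β - α) * ∑ b : Fin n, (q b).2 * (G b.castSucc - G b.succ) := by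
    rw [Finset.mul_sum, ← Finset.sum_add_distrib]
    exact Finset.sum_congr rfl fun j _ => by unfold lineAt; ring
  have hdiss : ∫⁻ τ in Icc α β, laxDissipation (avgSpeed f u v) u v τ
      ≤ ENNReal.ofReal ((β - α) * ∑ b, ℓ b) := by
    -- Lines may meet at the end times, which form a null set.
    rw [← restrict_Ioo_eq_restrict_Icc]
    refine (setLIntegral_mono' measurableSet_Ioo fun τ hτ => laxDissipation_le hu hv hτ).trans ?_
    rw [setLIntegral_const, Real.volume_Ioo, ← ENNReal.ofReal_sum_of_nonneg fun b _ => hℓ0 b, mul_comm,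
      ENNReal.ofReal_mul (by linarith)]
  have hβα : 0 ≤ β - α := by linarith
  have hM0 : 0 ≤ M := abs_nonneg _
  calc _ ≤ l1Dist u v β + ENNReal.ofReal ((β - α) * ∑ b, ℓ b) := by gcongr
    _ ≤ l1Dist u v α + ENNReal.ofReal (2 * h * (β - α) * M * W) := by
      rw [hα, hβ, ← ENNReal.ofReal_add hβ0 (mul_nonneg hβα (Finset.sum_nonneg fun b _ => hℓ0 b)),
        ← ENNReal.ofReal_add hα0 (by positivity)]
      refine ENNReal.ofReal_le_ofReal ?_
      have := mul_le_mul_of_nonneg_left hbal hβα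
      simp only [hG] at hdiff this
      linarith
    _ ≤ _ := by
      rw [ENNReal.ofReal_mul (by positivity), ENNReal.ofReal_mul (by positivity)]
      gcongr

end

end FrontTracking

namespace FrontTracking

/-! ### Decomposition in time -/

section

variable {f : ℝ → ℝ} {h : ℝ} {u v : ℝ → ℝ → ℝ}

section

variable {n : ℕ} {τ τ' : ℝ} {I : Set ℝ} {y σ : Fin n → ℝ} {c : Fin (n + 1) → ℝ}

/-- Lines that coincide at the initial time form a monotone fan, so the variation at that time
already sees all the strengths. -/
theorem IsFrontStrip.sum_le_totalVariation (hu : IsFrontStrip f h u τ I y σ c) (hτ : τ < τ')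
    (hI : Icc τ τ' ⊆ I) :
    ENNReal.ofReal (∑ j : Fin n, |c j.succ - c j.castSucc|) ≤ totalVariation u τ := by
  have hw := hu.isWeakStrip hI
  have hmem : τ ∈ Icc τ τ' := left_mem_Icc.mpr hτ.le
  refine (hw.step τ hmem).le_eVariationOn (monotone_lineAt_of_strictMono hτ hw.ordered hmem)
    fun i j hij => hu.fan i j ?_
  simpa [lineAt] using hij

theorem IsFrontStrip.totalVariation_le (hu : IsFrontStrip f h u τ I y σ c) (hτ : τ < τ')
    (hI : Icc τ τ' ⊆ I) : totalVariation u τ' ≤ totalVariation u τ := by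
  have hw := hu.isWeakStrip hI
  have hmem : τ' ∈ Icc τ τ' := right_mem_Icc.mpr hτ.le
  exact ((hw.step τ' hmem).eVariationOn_le
    (monotone_lineAt_of_strictMono hτ hw.ordered hmem)).trans (hu.sum_le_totalVariation hτ hI)

end

/-- `B` collects the times `T k`. An interval with no such time inside lies in the strip of the last
`T k ≤ α`, and the total variation does not increase from one `T k` to the next. -/
theorem IsFrontTracking.exists_strips (hu : IsFrontTracking f h u) :
    ∃ B : Finset ℝ, ∀ α β, 0 ≤ α → α < β → (∀ t ∈ Ioo α β, t ∉ B) →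
      ∃ (n : ℕ) (p : Fin n → ℝ × ℝ) (c : Fin (n + 1) → ℝ), IsWeakStrip f h u α β p c ∧
        ENNReal.ofReal (∑ j : Fin n, |c j.succ - c j.castSucc|) ≤ totalVariation u 0 := by
  classical
  obtain ⟨N, T, hT0, hT, hstrip, n, y, σ, c, hlast⟩ := hu
  have hTV : ∀ k ≤ N, totalVariation u (T k) ≤ totalVariation u 0 := by
    intro k
    induction k with
    | zero => intro _; rw [hT0]
    | succ k ih =>
      intro hk
      obtain ⟨n, y, σ, c, hk'⟩ := hstrip k hk
      exact (hk'.totalVariation_le (hT k hk) Subset.rfl).trans (ih (by omega))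
  refine ⟨(Finset.range (N + 1)).image T, fun α β hα hαβ hB => ?_⟩
  set k := Nat.findGreatest (fun k => T k ≤ α) N with hk
  have hkN : k ≤ N := Nat.findGreatest_le N
  have hkα : T k ≤ α := Nat.findGreatest_spec (P := fun k => T k ≤ α) (Nat.zero_le N) (by rwa [hT0])
  rcases hkN.lt_or_eq with hlt | heq
  · have hk1 : α < T (k + 1) := not_le.mp
      (Nat.findGreatest_is_greatest (P := fun k => T k ≤ α) (Nat.lt_succ_self k) hlt)
    have hβ : β ≤ T (k + 1) := by
      by_contra hcon
      exact hB _ ⟨hk1, not_le.mp hcon⟩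
        (Finset.mem_image_of_mem _ (Finset.mem_range.mpr (by omega)))
    obtain ⟨n, y, σ, c, hs⟩ := hstrip k hlt
    exact ⟨n, _, c, hs.isWeakStrip (Icc_subset_Icc hkα hβ),
      (hs.sum_le_totalVariation (hT k hlt) Subset.rfl).trans (hTV k hkN)⟩
  · rw [heq] at hkα
    exact ⟨n, _, c, hlast.isWeakStrip fun t ht => hkα.trans ht.1,
      (hlast.sum_le_totalVariation (lt_add_one (T N)) Icc_subset_Ici_self).trans (hTV N le_rfl)⟩

/-- A transitive relation between times which holds on all intervals that avoid a finite set
holds on all intervals. -/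
theorem of_avoiding_finset {P : ℝ → ℝ → Prop}
    (htrans : ∀ a b c, a < b → b < c → P a b → P b c → P a c) (B : Finset ℝ) {a b : ℝ} (hab : a < b)
    (H : ∀ a' b', a ≤ a' → a' < b' → b' ≤ b → (∀ t ∈ Ioo a' b', t ∉ B) → P a' b') : P a b := by
  classical
  induction B using Finset.induction_on generalizing a b with
  | empty => exact H a b le_rfl hab le_rfl fun _ _ => by simp
  | insert s B _ ih =>
    have sub : ∀ {a₁ b₁}, a ≤ a₁ → a₁ < b₁ → b₁ ≤ b → s ∉ Ioo a₁ b₁ → P a₁ b₁ := by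
      intro a₁ b₁ ha₁ hab₁ hb₁ hs
      refine ih hab₁ fun a' b' ha' hab' hb' hB => H a' b' (ha₁.trans ha') hab' (hb'.trans hb₁) ?_
      intro t ht
      rw [Finset.mem_insert, not_or]
      exact ⟨fun hts => hs (hts ▸ Ioo_subset_Ioo ha' hb' ht), hB t ht⟩
    by_cases hs : s ∈ Ioo a b
    · exact htrans a s b hs.1 hs.2 (sub le_rfl hs.1 hs.2.le fun hs' => lt_irrefl _ hs'.2)
        (sub hs.1.le hs.2 le_rfl fun hs' => lt_irrefl _ hs'.1)
    · exact sub le_rfl hab le_rfl hs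

/-- The quotient is the only meeting time of two lines of different speeds. For equal speeds it is 0
by convention, which is harmless: parallel lines that meet coincide. -/
theorem eq_of_lineAt_eq {p q : ℝ × ℝ} {t : ℝ} (heq : lineAt p t = lineAt q t)
    (ht : t ≠ (q.1 - p.1) / (p.2 - q.2)) : p = q := by
  unfold lineAt at heq
  by_cases h2 : p.2 = q.2
  · rw [h2] at heq
    exact Prod.ext (by linarith) h2
  · exact absurd (by rw [eq_div_iff (sub_ne_zero.mpr h2)]; linarith) ht

theorem exists_common_refinement {α β : ℝ} (hh : 0 ≤ h) {n m : ℕ} {p : Fin n → ℝ × ℝ}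
    {c : Fin (n + 1) → ℝ} {p' : Fin m → ℝ × ℝ} {c' : Fin (m + 1) → ℝ} (hαβ : α < β)
    (hu : IsWeakStrip f h u α β p c) (hv : IsWeakStrip f h v α β p' c')
    (hcross : ∀ i j, ∀ t ∈ Ioo α β, t ≠ ((p' j).1 - (p i).1) / ((p i).2 - (p' j).2)) :
    ∃ (k : ℕ) (q : Fin k → ℝ × ℝ) (U V : Fin (k + 1) → ℝ),
      IsWeakStrip f h u α β q U ∧ IsWeakStrip f h v α β q V ∧
      ∑ b : Fin k, |U b.succ - U b.castSucc| = ∑ i : Fin n, |c i.succ - c i.castSucc| ∧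
      ∑ b : Fin k, |V b.succ - V b.castSucc| = ∑ i : Fin m, |c' i.succ - c' i.castSucc| := by
  classical
  obtain ⟨k, q, hqL, hq⟩ := exists_sorted_lines (Finset.univ.image p ∪ Finset.univ.image p') hαβ (by
    intro a ha b hb t ht hab
    simp only [Finset.mem_union, Finset.mem_image, Finset.mem_univ, true_and] at ha hb
    rcases ha with ⟨i, rfl⟩ | ⟨i, rfl⟩ <;> rcases hb with ⟨j, rfl⟩ | ⟨j, rfl⟩
    · rw [(hu.ordered t ht).injective hab]
    · exact eq_of_lineAt_eq hab (hcross i j t ht)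
    · exact (eq_of_lineAt_eq hab.symm (hcross j i t ht)).symm
    · rw [(hv.ordered t ht).injective hab])
  obtain ⟨U, hU, hUs⟩ := hu.refine hh hαβ q hq fun i => hqL _ (by simp)
  obtain ⟨V, hV, hVs⟩ := hv.refine hh hαβ q hq fun i => hqL _ (by simp)
  exact ⟨k, q, U, V, hU, hV, hUs, hVs⟩

theorem IsWeakStrip.mem_of_forall {α β : ℝ} {n : ℕ} {p : Fin n → ℝ × ℝ} {c : Fin (n + 1) → ℝ}
    (hα : 0 ≤ α) (hαβ : α < β) (hu : IsWeakStrip f h u α β p c) {C : Set ℝ}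
    (hC : ∀ x t, 0 ≤ t → u x t ∈ C) (i : Fin (n + 1)) : c i ∈ C := by
  obtain ⟨m, hm⟩ : (Ioo α β).Nonempty := nonempty_Ioo.mpr hαβ
  obtain ⟨x, hx⟩ := (hu.step m (Ioo_subset_Icc_self hm)).exists_eq (hu.ordered m hm) i
  exact hx ▸ hC x m (hα.trans hm.1.le)

/-- Subadditivity of the integral over a union suffices, so `D` need not be measurable. -/
theorem add_lintegral_le_trans {F D : ℝ → ℝ≥0∞} {S W : ℝ≥0∞} (hh : 0 ≤ h) {a b c : ℝ} (hab : a < b)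
    (hbc : b < c)
    (h1 : F b + ∫⁻ τ in Icc a b, D τ ≤ F a + ENNReal.ofReal (2 * h * (b - a)) * S * W)
    (h2 : F c + ∫⁻ τ in Icc b c, D τ ≤ F b + ENNReal.ofReal (2 * h * (c - b)) * S * W) :
    F c + ∫⁻ τ in Icc a c, D τ ≤ F a + ENNReal.ofReal (2 * h * (c - a)) * S * W := by
  have hsplit : ENNReal.ofReal (2 * h * (c - a))
      = ENNReal.ofReal (2 * h * (b - a)) + ENNReal.ofReal (2 * h * (c - b)) := by
    rw [← ENNReal.ofReal_add (mul_nonneg (by positivity) (by linarith))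
      (mul_nonneg (by positivity) (by linarith))]
    congr 1; ring
  calc F c + ∫⁻ τ in Icc a c, D τ
      ≤ F c + ((∫⁻ τ in Icc a b, D τ) + ∫⁻ τ in Icc b c, D τ) := by
        rw [← Icc_union_Icc_eq_Icc hab.le hbc.le]
        exact add_le_add_right (lintegral_union_le _ _ _) _
    _ = (F c + ∫⁻ τ in Icc b c, D τ) + ∫⁻ τ in Icc a b, D τ := by ring
    _ ≤ (F b + ENNReal.ofReal (2 * h * (c - b)) * S * W) + ∫⁻ τ in Icc a b, D τ := by gcongr
    _ = (F b + ∫⁻ τ in Icc a b, D τ) + ENNReal.ofReal (2 * h * (c - b)) * S * W := by ring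
    _ ≤ (F a + ENNReal.ofReal (2 * h * (b - a)) * S * W)
          + ENNReal.ofReal (2 * h * (c - b)) * S * W := by gcongr
    _ = _ := by rw [hsplit]; ring

end

end FrontTracking

/-! ### Assembly of the estimate -/

theorem theorem3p1 (f : ℝ → ℝ) (hf : ContDiff ℝ 2 f) (h : ℝ) (hh : 0 < h)
    (uI uII : ℝ → ℝ → ℝ)
    (hI : FrontTracking.IsFrontTracking f h uI) (hII : FrontTracking.IsFrontTracking f h uII)
    (C : Set ℝ) (hC : Convex ℝ C)
    (hCI : ∀ x t, 0 ≤ t → uI x t ∈ C) (hCII : ∀ x t, 0 ≤ t → uII x t ∈ C)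
    (s t : ℝ) (hs : 0 ≤ s) (hst : s ≤ t) :
    FrontTracking.l1Dist uI uII t
        + ∫⁻ τ in Set.Icc s t,
            FrontTracking.laxDissipation (FrontTracking.avgSpeed f uI uII) uI uII τ
      ≤ FrontTracking.l1Dist uI uII s
        + ENNReal.ofReal (2 * h * (t - s)) * (⨆ w ∈ C, ‖deriv (deriv f) w‖ₑ)
          * (FrontTracking.totalVariation uI 0 + FrontTracking.totalVariation uII 0) := by
  open FrontTracking in
  classical
  rcases hst.eq_or_lt with rfl | hst
  · simp
  obtain ⟨BI, hBI⟩ := hI.exists_strips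
  obtain ⟨BII, hBII⟩ := hII.exists_strips
  set P : ℝ → ℝ → Prop := fun a b => l1Dist uI uII b
      + ∫⁻ τ in Icc a b, laxDissipation (avgSpeed f uI uII) uI uII τ
      ≤ l1Dist uI uII a + ENNReal.ofReal (2 * h * (b - a)) * (⨆ w ∈ C, ‖deriv (deriv f) w‖ₑ)
        * (totalVariation uI 0 + totalVariation uII 0) with hP
  have htrans : ∀ a b c, a < b → b < c → P a b → P b c → P a c := fun a b c hab hbc h1 h2 =>
    add_lintegral_le_trans hh.le hab hbc h1 h2
  change P s t
  refine of_avoiding_finset htrans (BI ∪ BII) hst fun a b hsa hab _ hB => ?_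
  simp only [Finset.mem_union, not_or] at hB
  obtain ⟨n, p, c, hu, hc⟩ := hBI a b (hs.trans hsa) hab fun t ht => (hB t ht).1
  obtain ⟨m, p', c', hv, hc'⟩ := hBII a b (hs.trans hsa) hab fun t ht => (hB t ht).2
  -- The crossing times are defined only once the strips, and so the lines, are fixed; hence a
  -- second subdivision.
  refine of_avoiding_finset htrans (Finset.univ.image fun ij : Fin n × Fin m =>
      ((p' ij.2).1 - (p ij.1).1) / ((p ij.1).2 - (p' ij.2).2)) hab fun α β haα hαβ hβb hX => ?_
  obtain ⟨k, q, U, V, hU, hV, hUs, hVs⟩ := exists_common_refinement hh.le hαβ (hu.mono haα hβb)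
    (hv.mono haα hβb) fun i j t ht heq => hX t ht (by
      rw [heq]
      exact Finset.mem_image_of_mem (fun ij : Fin n × Fin m =>
        ((p' ij.2).1 - (p ij.1).1) / ((p ij.1).2 - (p' ij.2).2)) (Finset.mem_univ (i, j)))
  have hα : 0 ≤ α := hs.trans (hsa.trans haα)
  refine (l1Dist_add_le_of_strip hf hh.le hαβ hU hV hC (hU.mem_of_forall hα hαβ hCI)
    (hV.mem_of_forall hα hαβ hCII)).trans ?_
  rw [hUs, hVs, ENNReal.ofReal_add (Finset.sum_nonneg fun _ _ => abs_nonneg _)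
    (Finset.sum_nonneg fun _ _ => abs_nonneg _)]
  gcongr
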